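/- Let $d\ge 1$ and let $\mathbb P$ be a probability measure on $\Omega=\mathbb R^{\mathbb Z^d}$ with its Borel $\sigma$-algebra. Let $d_{\mathrm{set}}(A,B)=\min\{\|x-y\|_1 : x\in A,\ y\in B\}$ denote the $\ell^1$-distance of subsets of $\mathbb Z^d$. Assume: * (translation invariance) for every $z\in\mathbb Z^d$ the translation $\gamma_z:\Omega\to\Omega$, $(\gamma_z\omega)_y=\omega_{y+z}$, is measurable and preserves $\mathbb P$; * (independence at a distance) $r\ge 0$ is such that, for every $k$ and all nonempty finite sets $\Lambda(1),\dots,\Lambda(k)\subset\mathbb Z^d$ with $d_{\mathrm{set}}(\Lambda(i),\Lambda(j))>r$ for $i\ne j$, the restrictions $\omega\mapsto(\omega_y)_{y\in\Lambda(i)}$, $1\le i\le k$, are independent under $\mathbb P$. For finite $\Lambda\subset\mathbb Z^d$ let $H_\omega^\Lambda=p_\Lambda H_\omega i_\Lambda$ on $\ell^2(\Lambda)$ be the compression to $\Lambda$ of the Anderson operator $$H_\omega\Psi(x)=\sum_{y:\,\|y-x\|_1=1}(\Psi(x)-\Psi(y))+\omega_x\Psi(x),$$ where $i_\Lambda$ is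 extension by zero and $p_\Lambda$ is restriction to $\Lambda$, and let $N(\Lambda,\omega)(x)$ be the number of eigenvalues of $H_\omega^\Lambda$ that are $\le x$, counted with multiplicity. Let $\Lambda_m=([0,m)\cap\mathbb Z)^d$ and $\Lambda_m^r=\{x\in\Lambda_m : d_{\mathrm{set}}(\{x\},\mathbb Z^d\setminus\Lambda_m)>r\}$, and assume $\Lambda_m^r\neq\emptyset$. Put $\Phi(x)=\mathbb E\big(N(\Lambda_m^r,\cdot)(x)/|\Lambda_m|\big)$ for $x\in\mathbb R$, let $\Phi^{-1}(\alpha)=\inf\{\lambda\in\mathbb R : \Phi(\lambda)\ge\alpha\}$ be its quantile function, and let $\Phi^{-1}(\mathbb Q)$ be the set of all real numbers of the form $\Phi^{-1}(\alpha)$ with $\alpha\in\mathbb Q$. Let $s\ge 1$ and let $\Lambda^r_{m,1},\dots,\Lambda^r_{m,s}$ be translates of $\Lambda_m^r$ by elements of $\mathbb Z^d$ such that $d_{\mathrm{set}}(\Lambda^r_{m,i},\Lambda^r_{m,j})>r$ for all $i\ne j$. Then, for all real $M\ge 2$ and $\kappa>0$, $$\mathbb P\left(\sup_{x\in\Phi^{-1}(\mathbb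 Q)}\left|\frac1s\sum_{i=1}^s\frac{N(\Lambda^r_{m,i},\omega)(x)}{|\Lambda_m|}-\mathbb E\,\frac{N(\Lambda^r_m,\cdot)(x)}{|\Lambda_m|}\right|\ge\kappa\right)\le M\exp\left(-\frac{\sqrt s\,\kappa}{K_M}\right),$$ where $$K_M=\left(10\cdot\frac{4(M+1)}{\log(3/2)\,(M-1)}+\frac{4}{\log M}\right)\sum_{q=0}^\infty 2^{-q}\sqrt{2+2q\log 2},$$ and the series in $K_M$ converges, so that $K_M<\infty$. -/

import Mathlib

open MeasureTheory ProbabilityTheory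
open scoped NNReal ENNReal

namespace AndersonIDS

/-- The lattice `ℤ^d`. -/
abbrev Site (d : ℕ) : Type := Fin d → ℤ

/-- Configurations `ω ∈ ℝ^(ℤ^d)`, with the product (equivalently Borel) `σ`-algebra. -/
abbrev Config (d : ℕ) : Type := Site d → ℝ

/-- The `ℓ¹`-metric on `ℤ^d`. -/
def l1Dist {d : ℕ} (x y : Site d) : ℕ := ∑ i, (x i - y i).natAbs

/-- The distance of two subsets of `ℤ^d` (infinite if one of them is empty). -/
noncomputable def setDist {d : ℕ} (A B : Set (Site d)) : ℝ≥0∞ :=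
  ⨅ x ∈ A, ⨅ y ∈ B, (l1Dist x y : ℝ≥0∞)

/-- The cube `([0, m) ∩ ℤ)^d`. -/
noncomputable def cube (d m : ℕ) : Finset (Site d) :=
  Fintype.piFinset fun _ => Finset.Ico (0 : ℤ) (m : ℤ)

open Classical in
/-- `Λ^r`: the points of `Λ` whose distance to the complement of `Λ` exceeds `r`. -/
noncomputable def core {d : ℕ} (r : ℝ≥0) (Λ : Finset (Site d)) : Finset (Site d) :=
  Λ.filter fun x => (r : ℝ≥0∞) < setDist {x} ((Λ : Set (Site d))ᶜ)

/-- The translateBy `Λ + z`. -/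
def translateBy {d : ℕ} (z : Site d) (Λ : Finset (Site d)) : Finset (Site d) :=
  Λ.map (addRightEmbedding z)

/-- The translation `(γ_z ω)_y = ω_(y + z)` of configurations. -/
def shift {d : ℕ} (z : Site d) (ω : Config d) : Config d := fun y => ω (y + z)

/-- Translation invariance: every `γ_z` is measurable and preserves `P`. -/
def TranslationInvariant {d : ℕ} (P : Measure (Config d)) : Prop :=
  ∀ z : Site d, MeasurePreserving (shift z) P P

/-- Independence at distances larger than `r`: the restrictions of the configuration to finitely
many nonempty finite sets with mutual distances larger than `r` are independent. -/
def IndependentAtDistance {d : ℕ} (P : Measure (Config d)) (r : ℝ≥0) : Prop :=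
  ∀ (k : ℕ) (Λ : Fin k → Finset (Site d)),
    (∀ i, (Λ i).Nonempty) →
    (∀ i j, i ≠ j → (r : ℝ≥0∞) < setDist (Λ i : Set (Site d)) (Λ j : Set (Site d))) →
    iIndepFun (fun (i : Fin k) (ω : Config d) => (Λ i).restrict ω) P

/-- The nearest neighbours of `x`, that is the points at `ℓ¹`-distance one. -/
noncomputable def neighbors {d : ℕ} (x : Site d) : Finset (Site d) :=
  (Finset.Icc (x - 1) (x + 1)).filter fun y => l1Dist y x = 1

theorem mem_neighbors {d : ℕ} (x y : Site d) : y ∈ neighbors x ↔ l1Dist y x = 1 := by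
  simp only [neighbors, Finset.mem_filter, and_iff_right_iff_imp, Finset.mem_Icc, Pi.le_def]
  intro h
  have key : ∀ i, (y i - x i).natAbs ≤ 1 := fun i => by
    rw [← h]
    exact Finset.single_le_sum (f := fun i => (y i - x i).natAbs)
      (fun _ _ => Nat.zero_le _) (Finset.mem_univ i)
  constructor <;> intro i <;> have := key i <;> simp <;> omega

theorem l1Dist_comm {d : ℕ} (x y : Site d) : l1Dist x y = l1Dist y x := by
  unfold l1Dist
  exact Finset.sum_congr rfl fun i _ => by omega

/-- The action of the Anderson operator `H_ω = -Δ + V_ω` on functions on `ℤ^d`. It is a finite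
expression at every point, so that the (possibly unbounded) operator on `ℓ²(ℤ^d)` and this map
have the same compressions to finite sets. -/
noncomputable def anderson {d : ℕ} (ω : Config d) : (Site d → ℂ) →ₗ[ℂ] (Site d → ℂ) where
  toFun ψ x := ∑ y ∈ neighbors x, (ψ x - ψ y) + (ω x : ℂ) * ψ x
  map_add' ψ φ := by
    funext x
    simp only [Pi.add_apply, mul_add, add_sub_add_comm]
    rw [Finset.sum_add_distrib]
    ring
  map_smul' c ψ := by
    funext x
    simp only [Pi.smul_apply, smul_eq_mul, RingHom.id_apply, mul_add, Finset.mul_sum, mul_sub]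
    ring_nf

/-- The embedding `i_Λ` by zero. -/
noncomputable def embed {d : ℕ} (Λ : Finset (Site d)) : (Λ → ℂ) →ₗ[ℂ] (Site d → ℂ) :=
  Function.ExtendByZero.linearMap ℂ (Subtype.val : Λ → Site d)

/-- The projection `p_Λ`, that is the restriction to `Λ`. -/
def proj {d : ℕ} (Λ : Finset (Site d)) : (Site d → ℂ) →ₗ[ℂ] (Λ → ℂ) :=
  LinearMap.funLeft ℂ ℂ (Subtype.val : Λ → Site d)

/-- The matrix of the restricted Anderson operator `H_ω^Λ = p_Λ H_ω i_Λ` in the standard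
orthonormal basis of `ℓ²(Λ)`. -/
noncomputable def restricted {d : ℕ} (Λ : Finset (Site d)) (ω : Config d) : Matrix Λ Λ ℂ :=
  LinearMap.toMatrix' (proj Λ ∘ₗ anderson ω ∘ₗ embed Λ)

theorem embed_single {d : ℕ} (Λ : Finset (Site d)) (b : Λ) (x : Site d) :
    embed Λ (Pi.single b 1) x = if x = b then 1 else 0 := by
  by_cases hx : x ∈ Λ
  · have := Subtype.val_injective.extend_apply (Pi.single b 1 : Λ → ℂ) 0 (⟨x, hx⟩ : Λ)
    simp only [embed, Function.ExtendByZero.linearMap_apply]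
    rw [this, Pi.single_apply]
    simp [Subtype.ext_iff]
  · simp only [embed, Function.ExtendByZero.linearMap_apply]
    rw [Function.extend_apply' _ _ _ (by rintro ⟨a, rfl⟩; exact hx a.2)]
    have : x ≠ b := fun h => hx (h ▸ b.2)
    simp [this]

theorem restricted_apply {d : ℕ} (Λ : Finset (Site d)) (ω : Config d) (a b : Λ) :
    restricted Λ ω a b =
      (if a = b then ((neighbors (a : Site d)).card : ℂ) + (ω a : ℂ) else 0)
        - (if l1Dist (b : Site d) a = 1 then 1 else 0) := by
  have h : restricted Λ ω a b = anderson ω (embed Λ (Pi.single b 1)) a := by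
    simp [restricted, LinearMap.toMatrix'_apply, proj, LinearMap.funLeft]
  rw [h]
  simp only [anderson, LinearMap.coe_mk, AddHom.coe_mk, embed_single, Finset.sum_sub_distrib,
    Finset.sum_ite_eq', mem_neighbors, Finset.sum_const, nsmul_eq_mul, Subtype.ext_iff]
  split_ifs <;> ring

theorem restricted_isHermitian {d : ℕ} (Λ : Finset (Site d)) (ω : Config d) :
    (restricted Λ ω).IsHermitian := by
  ext a b
  rw [Matrix.conjTranspose_apply, restricted_apply, restricted_apply,
    l1Dist_comm (a : Site d) b]
  by_cases hab : a = b
  · subst hab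
    split_ifs <;> simp
  · have hba : b ≠ a := fun h => hab h.symm
    simp only [if_neg hab, if_neg hba]
    split_ifs <;> simp

/-- The eigenvalue counting function `N(Λ, ω)(x)`: the number of eigenvalues of `H_ω^Λ` that are
at most `x`, counted with multiplicity. -/
noncomputable def evcf {d : ℕ} (Λ : Finset (Site d)) (ω : Config d) (x : ℝ) : ℕ :=
  Nat.card {i : Λ // (restricted_isHermitian Λ ω).eigenvalues i ≤ x}

/-- `Φ(x) = 𝔼 (N(Λ_m^r, ·)(x) / |Λ_m|)`. -/
noncomputable def meanEvcf {d : ℕ} (P : Measure (Config d)) (r : ℝ≥0) (m : ℕ) (x : ℝ) : ℝ :=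
  ∫ ω, (evcf (core r (cube d m)) ω x : ℝ) / ((cube d m).card : ℝ) ∂P

/-- The quantile function (generalized inverse) `F⁻¹(α) = inf {t ∈ ℝ | F t ≥ α}`, with values in
the extended reals. -/
noncomputable def quantile (F : ℝ → ℝ) (α : ℝ) : EReal :=
  ⨅ t ∈ {t : ℝ | α ≤ F t}, (t : EReal)

/-- The real numbers in the image `F⁻¹(ℚ)` of `ℚ` under the quantile function. -/
def rationalQuantiles (F : ℝ → ℝ) : Set ℝ :=
  {x : ℝ | ∃ q : ℚ, quantile F (q : ℝ) = (x : EReal)}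

/-- The summand `2^(-q) √(2 + 2 q log 2)` in the constant `K_M`. -/
noncomputable def entropyTerm (q : ℕ) : ℝ :=
  ((2 : ℝ) ^ q)⁻¹ * √(2 + 2 * (q : ℝ) * Real.log 2)

/-- The constant `K_M`. -/
noncomputable def concConst (M : ℝ) : ℝ :=
  (10 * (4 * (M + 1) / (Real.log (3 / 2) * (M - 1))) + 4 / Real.log M) * ∑' q : ℕ, entropyTerm q

end AndersonIDS

open AndersonIDS

/-! Translation invariance and independence at a distance make the potentials on the `s` separated
translates i.i.d. copies of the potential on one core `Λ`. The claim thus concerns the supremum,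
over a countable set of `x`, of an empirical process whose functions have values in `[0, 1]`: counts
of eigenvalues divided by `N ≥ |Λ|`.

Symmetrization bounds its exponential moments by averages over random signs with the samples fixed.
For a fixed eigenvalue label, a signed sum of indicators of `(-∞, x]` is a partial sum of a random
walk, ordered by the sample points, so one maximal inequality controls all `x` at once
(`exists_cosh_bound`). Jensen's inequality over the labels keeps the bound independent of `|Λ|`. The
outcome is `𝔼 exp (c * sup) ≤ 4 exp (2 s c²)` for the unnormalized sums
(`integral_exp_iSup_evcf_le`).

Chernoff's inequality with `c` of order `1 / (K_M √s)` finishes the proof: only `K_M ≥ 40` matters,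
and the claim is trivial when its right-hand side is at least one. Measurability comes from upper
semicontinuity of the count in the potential and countability of the set of `x`. -/

namespace AndersonIDS

/-! ### Random signs and a maximal inequality for half-line indicators -/

section Signs

variable {ι : Type*} [Fintype ι] [DecidableEq ι]

/-- Flipping the sign at `a` annihilates the average of a function that is odd in this sign. -/
theorem sum_sign_mul_eq_zero (a : ι) (g : (ι → ℤˣ) → ℝ)
    (hg : ∀ ε, g (Pi.mulSingle a (-1) * ε) = g ε) :
    ∑ ε : ι → ℤˣ, ((ε a : ℤ) : ℝ) * g ε = 0 := by
  have h := Equiv.sum_comp (Equiv.mulLeft (Pi.mulSingle a (-1 : ℤˣ) : ι → ℤˣ))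
    (fun ε : ι → ℤˣ => ((ε a : ℤ) : ℝ) * g ε)
  simp only [Equiv.coe_mulLeft, hg, Pi.mul_apply, Pi.mulSingle_eq_same, neg_mul, one_mul,
    Units.val_neg, Int.cast_neg, Finset.sum_neg_distrib] at h
  linarith

/-- A maximal inequality for signed empirical distribution functions. -/
theorem exists_cosh_bound (X : ι → ℝ) (μ : ℝ) (T : Finset ι) :
    ∃ b : (ι → ℤˣ) → ℝ, (∀ ε ε', (∀ i ∈ T, ε i = ε' i) → b ε = b ε') ∧ (∀ ε, 0 ≤ b ε) ∧
      (∀ ε x, ∑ i ∈ T, (if X i ≤ x then ((ε i : ℤ) : ℝ) else 0) ≤ b ε) ∧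
      ∑ ε, Real.cosh (μ * b ε) ≤ Fintype.card (ι → ℤˣ) * Real.cosh μ ^ T.card := by
  -- Points are inserted in decreasing order of `X`, so each half-line sum starts at the newest
  -- point. Hence `max 0 (ε a + b)` dominates all of them, zero being the sum over no points.
  induction T using Finset.induction_on_min_value X with
  | empty => exact ⟨fun _ => 0, by simp, by simp, by simp, by simp⟩
  | insert a T ha hmin ih =>
    obtain ⟨b, hdep, hb0, hb, hsum⟩ := ih
    refine ⟨fun ε => max 0 ((ε a : ℤ) + b ε), fun ε ε' h => ?_, fun ε => le_max_left _ _,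
      fun ε x => ?_, ?_⟩
    · simp only
      rw [h a (Finset.mem_insert_self a T),
        hdep ε ε' fun i hi => h i (Finset.mem_insert_of_mem hi)]
    · rw [Finset.sum_insert ha]
      by_cases hx : X a ≤ x
      · rw [if_pos hx]
        exact le_max_of_le_right (by linarith [hb ε x])
      · rw [if_neg hx, Finset.sum_eq_zero]
        · simp
        · intro i hi
          rw [if_neg fun h => hx ((hmin i hi).trans h)]
    -- Truncation at zero decreases `cosh`. In the addition formula the `sinh` term is odd in `ε a`,
    -- as `b` ignores that sign, so it averages out and each point costs one factor `cosh μ`.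
    · have hpt : ∀ ε : ι → ℤˣ, Real.cosh (μ * max 0 ((ε a : ℤ) + b ε)) ≤
          Real.cosh μ * Real.cosh (μ * b ε) +
            ((ε a : ℤ) : ℝ) * (Real.sinh μ * Real.sinh (μ * b ε)) := by
        intro ε
        have h1 : Real.cosh (μ * max 0 ((ε a : ℤ) + b ε)) ≤
            Real.cosh (μ * ((ε a : ℤ) + b ε)) := by
          rw [Real.cosh_le_cosh, abs_mul, abs_mul]
          refine mul_le_mul_of_nonneg_left ?_ (abs_nonneg μ)
          rw [abs_of_nonneg (le_max_left _ _)]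
          exact max_le (abs_nonneg _) (le_abs_self _)
        refine h1.trans (le_of_eq ?_)
        rcases Int.units_eq_one_or (ε a) with h | h
        · simp [h, mul_add, Real.cosh_add]
        · simp [h, mul_add, Real.cosh_add]
      have hodd := sum_sign_mul_eq_zero a (fun ε => Real.sinh μ * Real.sinh (μ * b ε))
        (fun ε => by
          rw [hdep (Pi.mulSingle a (-1) * ε) ε fun i hi => by
            rw [Pi.mul_apply, Pi.mulSingle_eq_of_ne (ne_of_mem_of_not_mem hi ha), one_mul]])
      calc ∑ ε : ι → ℤˣ, Real.cosh (μ * max 0 ((ε a : ℤ) + b ε))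
          ≤ ∑ ε : ι → ℤˣ, (Real.cosh μ * Real.cosh (μ * b ε) +
            ((ε a : ℤ) : ℝ) * (Real.sinh μ * Real.sinh (μ * b ε))) :=
            Finset.sum_le_sum fun ε _ => hpt ε
        _ = Real.cosh μ * ∑ ε, Real.cosh (μ * b ε) := by
            rw [Finset.sum_add_distrib, hodd, add_zero, Finset.mul_sum]
        _ ≤ Real.cosh μ * (Fintype.card (ι → ℤˣ) * Real.cosh μ ^ T.card) :=
            mul_le_mul_of_nonneg_left hsum (Real.cosh_pos μ).le
        _ = _ := by rw [Finset.card_insert_of_notMem ha, pow_succ]; ring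

/-- Flipping all signs turns the upper bound into a lower one. The constant `4` is two from `exp ≤ 2
cosh` times two for the two sides, and `cosh μ ≤ exp (μ² / 2)` gives the Gaussian factor. -/
theorem exists_exp_bound (X : ι → ℝ) (μ : ℝ) :
    ∃ b : (ι → ℤˣ) → ℝ, (∀ ε, 0 ≤ b ε) ∧
      (∀ ε x, |∑ i, (if X i ≤ x then ((ε i : ℤ) : ℝ) else 0)| ≤ b ε) ∧
      ∑ ε, Real.exp (μ * b ε) ≤
        Fintype.card (ι → ℤˣ) * (4 * Real.exp (Fintype.card ι * (μ ^ 2 / 2))) := by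
  obtain ⟨b, -, hb0, hb, hsum⟩ := exists_cosh_bound X μ Finset.univ
  have hexp : ∀ y : ℝ, Real.exp y ≤ 2 * Real.cosh y := fun y => by
    rw [Real.cosh_eq]
    linarith [Real.exp_pos (-y)]
  refine ⟨fun ε => max (b ε) (b (-ε)), fun ε => le_max_of_le_left (hb0 ε), fun ε x => ?_, ?_⟩
  · refine abs_le'.2 ⟨le_max_of_le_left (hb ε x), le_max_of_le_right ?_⟩
    refine le_trans (le_of_eq ?_) (hb (-ε) x)
    rw [← Finset.sum_neg_distrib]
    refine Finset.sum_congr rfl fun i _ => ?_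
    split_ifs <;> simp
  · have hpt : ∀ ε : ι → ℤˣ, Real.exp (μ * max (b ε) (b (-ε))) ≤
        2 * Real.cosh (μ * b ε) + 2 * Real.cosh (μ * b (-ε)) := by
      intro ε
      have h1 := Real.cosh_pos (μ * b ε)
      have h2 := Real.cosh_pos (μ * b (-ε))
      rcases max_choice (b ε) (b (-ε)) with h | h <;> rw [h]
      · linarith [hexp (μ * b ε)]
      · linarith [hexp (μ * b (-ε))]
    have hneg := Equiv.sum_comp (Equiv.neg (ι → ℤˣ)) (fun ε => Real.cosh (μ * b ε))
    simp only [Equiv.neg_apply] at hneg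
    have hcosh : Real.cosh μ ^ (Finset.univ : Finset ι).card ≤
        Real.exp (Fintype.card ι * (μ ^ 2 / 2)) := by
      rw [Finset.card_univ, Real.exp_nat_mul]
      exact pow_le_pow_left₀ (Real.cosh_pos μ).le (Real.cosh_le_exp_half_sq μ) _
    calc ∑ ε : ι → ℤˣ, Real.exp (μ * max (b ε) (b (-ε)))
        ≤ ∑ ε : ι → ℤˣ, (2 * Real.cosh (μ * b ε) + 2 * Real.cosh (μ * b (-ε))) :=
          Finset.sum_le_sum fun ε _ => hpt ε
      _ = 4 * ∑ ε, Real.cosh (μ * b ε) := by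
          rw [Finset.sum_add_distrib, ← Finset.mul_sum, ← Finset.mul_sum, hneg]
          ring
      _ ≤ 4 * (Fintype.card (ι → ℤˣ) * Real.exp (Fintype.card ι * (μ ^ 2 / 2))) := by
          refine mul_le_mul_of_nonneg_left (hsum.trans ?_) (by norm_num)
          exact mul_le_mul_of_nonneg_left hcosh (Nat.cast_nonneg _)
      _ = _ := by ring

/-- The average over finitely many samples of the bounds of `exists_exp_bound`. -/
theorem exists_exp_bound_average {J : Type*} [Fintype J] [Nonempty J] (X : J → ι → ℝ) (μ : ℝ) :
    ∃ b : (ι → ℤˣ) → ℝ, (∀ ε, 0 ≤ b ε) ∧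
      (∀ ε (x : ℝ), (Fintype.card J : ℝ)⁻¹ *
        ∑ j, |∑ i, (if X j i ≤ x then ((ε i : ℤ) : ℝ) else 0)| ≤ b ε) ∧
      ∑ ε, Real.exp (μ * b ε) ≤
        Fintype.card (ι → ℤˣ) * (4 * Real.exp (Fintype.card ι * (μ ^ 2 / 2))) := by
  choose b hb0 hb hsum using fun j => exists_exp_bound (X j) μ
  have hJ : (0 : ℝ) < Fintype.card J := by exact_mod_cast Fintype.card_pos
  refine ⟨fun ε => (Fintype.card J : ℝ)⁻¹ * ∑ j, b j ε,
    fun ε => mul_nonneg (inv_nonneg.2 hJ.le) (Finset.sum_nonneg fun j _ => hb0 j ε),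
    fun ε x => mul_le_mul_of_nonneg_left (Finset.sum_le_sum fun j _ => hb j ε x)
      (inv_nonneg.2 hJ.le), ?_⟩
  have hpt : ∀ ε, Real.exp (μ * ((Fintype.card J : ℝ)⁻¹ * ∑ j, b j ε)) ≤
      ∑ j, (Fintype.card J : ℝ)⁻¹ * Real.exp (μ * b j ε) := by
    intro ε
    have := convexOn_exp.map_sum_le (t := Finset.univ) (w := fun _ : J => (Fintype.card J : ℝ)⁻¹)
      (p := fun j => μ * b j ε) (fun _ _ => inv_nonneg.2 hJ.le)
      (by simp [hJ.ne']) (fun _ _ => Set.mem_univ _)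
    refine le_trans (le_of_eq ?_) this
    congr 1
    simp only [smul_eq_mul, Finset.mul_sum]
    exact Finset.sum_congr rfl fun j _ => by ring
  calc _ ≤ ∑ ε, ∑ j, (Fintype.card J : ℝ)⁻¹ * Real.exp (μ * b j ε) :=
        Finset.sum_le_sum fun ε _ => hpt ε
    _ = ∑ j, (Fintype.card J : ℝ)⁻¹ * ∑ ε, Real.exp (μ * b j ε) := by
        rw [Finset.sum_comm]
        simp only [Finset.mul_sum]
    _ ≤ ∑ _j : J, (Fintype.card J : ℝ)⁻¹ *
          (Fintype.card (ι → ℤˣ) * (4 * Real.exp (Fintype.card ι * (μ ^ 2 / 2)))) :=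
        Finset.sum_le_sum fun j _ => mul_le_mul_of_nonneg_left (hsum j) (inv_nonneg.2 hJ.le)
    _ = _ := by
        rw [Finset.sum_const, Finset.card_univ, nsmul_eq_mul, ← mul_assoc, mul_inv_cancel₀ hJ.ne',
          one_mul]

/-- A maximal inequality for the signed differences of two samples of sums of indicator
functions of half-lines. -/
theorem exists_exp_bound_sub {K : Type*} [Fintype K] [Nonempty K] (X Y : K → ι → ℝ) {N : ℝ}
    (hN : Fintype.card K ≤ N) (c : ℝ) :
    ∃ b : (ι → ℤˣ) → ℝ, (∀ ε, 0 ≤ b ε) ∧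
      (∀ ε (x : ℝ), |∑ i, ((ε i : ℤ) : ℝ) *
        ((∑ k, if X k i ≤ x then (1 : ℝ) else 0) / N -
          (∑ k, if Y k i ≤ x then (1 : ℝ) else 0) / N)| ≤ b ε) ∧
      ∑ ε, Real.exp (c * b ε) ≤
        Fintype.card (ι → ℤˣ) * (4 * Real.exp (2 * Fintype.card ι * c ^ 2)) := by
  -- Both samples are pooled into one family of `2|K|` members. Its average carries the weight `1 /
  -- (2|K|)`, whence the factor `2` in the bound and in the exponent.
  obtain ⟨b, hb0, hb, hsum⟩ := exists_exp_bound_average (Sum.elim X Y) (2 * c)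
  have hK : (0 : ℝ) < Fintype.card K := by exact_mod_cast Fintype.card_pos
  refine ⟨fun ε => 2 * b ε, fun ε => mul_nonneg zero_le_two (hb0 ε), fun ε x => ?_, ?_⟩
  · have hcomb : ∑ i, ((ε i : ℤ) : ℝ) * ((∑ k, if X k i ≤ x then (1 : ℝ) else 0) / N -
          (∑ k, if Y k i ≤ x then (1 : ℝ) else 0) / N) =
        N⁻¹ * (∑ k, ∑ i, (if X k i ≤ x then ((ε i : ℤ) : ℝ) else 0) -
          ∑ k, ∑ i, (if Y k i ≤ x then ((ε i : ℤ) : ℝ) else 0)) := by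
      rw [Finset.sum_comm (s := (Finset.univ : Finset K)),
        Finset.sum_comm (s := (Finset.univ : Finset K)), ← Finset.sum_sub_distrib,
        Finset.mul_sum]
      refine Finset.sum_congr rfl fun i _ => ?_
      rw [← sub_div, mul_div_assoc', div_eq_inv_mul, mul_sub, Finset.mul_sum, Finset.mul_sum]
      simp only [mul_ite, mul_one, mul_zero]
    have hbx := hb ε x
    rw [Fintype.sum_sum_type, Fintype.card_sum] at hbx
    simp only [Sum.elim_inl, Sum.elim_inr, Nat.cast_add] at hbx
    rw [hcomb, abs_mul, abs_inv, abs_of_pos (hK.trans_le hN)]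
    have h1 : |∑ k, ∑ i, (if X k i ≤ x then ((ε i : ℤ) : ℝ) else 0) -
          ∑ k, ∑ i, (if Y k i ≤ x then ((ε i : ℤ) : ℝ) else 0)| ≤
        ∑ k, |∑ i, (if X k i ≤ x then ((ε i : ℤ) : ℝ) else 0)| +
          ∑ k, |∑ i, (if Y k i ≤ x then ((ε i : ℤ) : ℝ) else 0)| :=
      (abs_sub _ _).trans (add_le_add (Finset.abs_sum_le_sum_abs _ _)
        (Finset.abs_sum_le_sum_abs _ _))
    refine (mul_le_mul (inv_anti₀ hK hN) h1 (abs_nonneg _) (inv_nonneg.2 hK.le)).trans ?_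
    have hhalf : ∀ A : ℝ, (Fintype.card K : ℝ)⁻¹ * A =
        2 * (((Fintype.card K : ℝ) + Fintype.card K)⁻¹ * A) := fun A => by
      field_simp
      ring
    exact (hhalf _).le.trans (mul_le_mul_of_nonneg_left hbx zero_le_two)
  · refine le_trans (le_of_eq ?_) (hsum.trans (le_of_eq ?_))
    · exact Finset.sum_congr rfl fun ε _ => by ring_nf
    · ring_nf

end Signs

/-! ### Symmetrization of empirical processes -/

section Symmetrization

variable {ι E C : Type*} [Fintype ι]

theorem abs_sum_sign_mul_sub_le {f : C → E → ℝ} (h0 : ∀ x e, 0 ≤ f x e) (h1 : ∀ x e, f x e ≤ 1)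
    (ε : ι → ℤˣ) (w : ι → E × E) (x : C) :
    |∑ i, ((ε i : ℤ) : ℝ) * (f x (w i).1 - f x (w i).2)| ≤ Fintype.card ι := by
  refine (Finset.abs_sum_le_sum_abs _ _).trans ?_
  rw [← Finset.card_univ, ← nsmul_one, ← Finset.sum_const]
  refine Finset.sum_le_sum fun i _ => ?_
  have : |((ε i : ℤ) : ℝ)| = 1 := by
    rcases Int.units_eq_one_or (ε i) with h | h <;> simp [h]
  rw [abs_mul, this, one_mul, abs_le]
  constructor <;> linarith [h0 x (w i).1, h1 x (w i).1, h0 x (w i).2, h1 x (w i).2]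

theorem abs_sum_sub_integral_le [MeasurableSpace E] {ν : Measure E} [IsProbabilityMeasure ν] {f : C → E → ℝ}
    (h0 : ∀ x e, 0 ≤ f x e) (h1 : ∀ x e, f x e ≤ 1) (u : ι → E) (x : C) :
    |∑ i, (f x (u i) - ∫ e, f x e ∂ν)| ≤ Fintype.card ι := by
  refine (Finset.abs_sum_le_sum_abs _ _).trans ?_
  rw [← Finset.card_univ, ← nsmul_one, ← Finset.sum_const]
  refine Finset.sum_le_sum fun i _ => ?_
  have hn : 0 ≤ ∫ e, f x e ∂ν := integral_nonneg (h0 x)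
  have hn1 : ∫ e, f x e ∂ν ≤ 1 := by
    -- Measurability of `f x` is not assumed; a nonintegrable function has integral `0` by
    -- convention.
    by_cases hint : Integrable (f x) ν
    · simpa using integral_mono hint (integrable_const (1 : ℝ)) (h1 x)
    · rw [integral_undef hint]
      exact zero_le_one
  rw [abs_le]
  constructor <;> linarith [h0 x (u i), h1 x (u i)]

/-- Countability of `C` makes the supremum measurable. The condition `0 ≤ B` covers an empty `C`,
where the real supremum is `0`. -/
theorem integrable_exp_iSup_abs [Countable C] {Ω : Type*} [MeasurableSpace Ω] {μ : Measure Ω}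
    [IsFiniteMeasure μ] {g : C → Ω → ℝ} (hg : ∀ x, Measurable (g x)) {B : ℝ}
    (hB0 : 0 ≤ B) (hB : ∀ x ω, |g x ω| ≤ B) {c : ℝ} (hc : 0 ≤ c) :
    Integrable (fun ω => Real.exp (c * ⨆ x, |g x ω|)) μ := by
  refine Integrable.of_bound (C := Real.exp (c * B)) ?_ (Filter.Eventually.of_forall fun ω => ?_)
  · exact (Real.measurable_exp.comp
      ((Measurable.iSup fun x => (hg x).abs).const_mul c)).aestronglyMeasurable
  · rw [Real.norm_of_nonneg (Real.exp_pos _).le]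
    exact Real.exp_le_exp.2 (mul_le_mul_of_nonneg_left (Real.iSup_le (fun x => hB x ω) hB0) hc)

/-- Exchanging the two samples at the indices with a negative sign preserves the law of a pair of
independent samples. -/
theorem integral_signed_eq [MeasurableSpace E] [Countable C] (ν : Measure E)
    [IsProbabilityMeasure ν] (f : C → E → ℝ) (hf : ∀ x, Measurable (f x)) (c : ℝ) (ε : ι → ℤˣ) :
    ∫ w : ι → E × E, Real.exp (c * ⨆ x, |∑ i, ((ε i : ℤ) : ℝ) * (f x (w i).1 - f x (w i).2)|)
        ∂(Measure.pi fun _ => ν.prod ν) =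
      ∫ w : ι → E × E, Real.exp (c * ⨆ x, |∑ i, (f x (w i).1 - f x (w i).2)|)
        ∂(Measure.pi fun _ => ν.prod ν) := by
  have hmp : MeasurePreserving (fun (w : ι → E × E) i => (if ε i = 1 then id else Prod.swap) (w i))
      (Measure.pi fun _ => ν.prod ν) (Measure.pi fun _ => ν.prod ν) := by
    refine measurePreserving_pi (f := fun i => if ε i = 1 then id else Prod.swap) _ _ fun i => ?_
    split_ifs
    · exact MeasurePreserving.id _
    · exact Measure.measurePreserving_swap
  -- Swapping the `i`-th pair negates the `i`-th difference, so the change of variables produces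
  -- exactly the signs `ε`.
  conv_rhs => rw [← hmp.map_eq]
  rw [integral_map hmp.measurable.aemeasurable]
  · refine integral_congr_ae (Filter.Eventually.of_forall fun w => ?_)
    simp only
    congr 2
    refine iSup_congr fun x => congrArg _ (Finset.sum_congr rfl fun i _ => ?_)
    rcases Int.units_eq_one_or (ε i) with h | h
    · simp [h]
    · simp [h, show (-1 : ℤˣ) ≠ 1 by decide]
  · refine (Real.measurable_exp.comp
      ((Measurable.iSup fun x => Measurable.abs ?_).const_mul c)).aestronglyMeasurable
    have := hf x
    fun_prop

/-- The expectation of a bounded process may be replaced by an independent second sample. -/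
theorem exp_iSup_abs_sum_sub_integral_le [MeasurableSpace E] [Countable C] (ν : Measure E)
    [IsProbabilityMeasure ν] (f : C → E → ℝ) (hf : ∀ x, Measurable (f x))
    (h0 : ∀ x e, 0 ≤ f x e) (h1 : ∀ x e, f x e ≤ 1) {c : ℝ} (hc : 0 ≤ c) (u : ι → E) :
    Real.exp (c * ⨆ x, |∑ i, (f x (u i) - ∫ e, f x e ∂ν)|) ≤
      ∫ u' : ι → E, Real.exp (c * ⨆ x, |∑ i, (f x (u i) - f x (u' i))|)
        ∂(Measure.pi fun _ => ν) := by
  have hn : (0 : ℝ) ≤ Fintype.card ι := Nat.cast_nonneg _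
  have hpair : ∀ (u' : ι → E) x, |∑ i, (f x (u i) - f x (u' i))| ≤ Fintype.card ι :=
    fun u' x => by simpa using abs_sum_sign_mul_sub_le h0 h1 (fun _ => 1) (fun i => (u i, u' i)) x
  have hfint : ∀ x, Integrable (f x) ν := fun x =>
    Integrable.of_bound (hf x).aestronglyMeasurable (C := 1)
      (Filter.Eventually.of_forall fun e => by
        rw [Real.norm_of_nonneg (h0 x e)]
        exact h1 x e)
  have hmeas : ∀ x, Measurable fun u' : ι → E => ∑ i, (f x (u i) - f x (u' i)) := fun x => by
    have := hf x
    fun_prop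
  have hsup : Integrable (fun u' : ι → E => ⨆ x, |∑ i, (f x (u i) - f x (u' i))|)
      (Measure.pi fun _ => ν) := by
    refine Integrable.of_bound (C := Fintype.card ι)
      (Measurable.iSup fun x => (hmeas x).abs).aestronglyMeasurable
      (Filter.Eventually.of_forall fun u' => ?_)
    rw [Real.norm_of_nonneg (Real.iSup_nonneg fun x => abs_nonneg _)]
    exact Real.iSup_le (fun x => hpair u' x) hn
  have hle : (⨆ x, |∑ i, (f x (u i) - ∫ e, f x e ∂ν)|) ≤
      ∫ u' : ι → E, (⨆ x, |∑ i, (f x (u i) - f x (u' i))|) ∂(Measure.pi fun _ => ν) := by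
    refine Real.iSup_le (fun x => ?_)
      (integral_nonneg fun u' => Real.iSup_nonneg fun x => abs_nonneg _)
    have hi : ∀ i, Integrable (fun u' : ι → E => f x (u' i)) (Measure.pi fun _ => ν) := fun i =>
      (measurePreserving_eval (fun _ : ι => ν) i).integrable_comp_of_integrable (hfint x)
    have hd : ∀ i, Integrable (fun u' : ι → E => f x (u i) - f x (u' i))
        (Measure.pi fun _ => ν) := fun i => (integrable_const _).sub (hi i)
    have heq : ∑ i, (f x (u i) - ∫ e, f x e ∂ν) =
        ∫ u' : ι → E, ∑ i, (f x (u i) - f x (u' i)) ∂(Measure.pi fun _ => ν) := by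
      rw [integral_finsetSum _ fun i _ => hd i]
      refine Finset.sum_congr rfl fun i _ => ?_
      rw [integral_sub (integrable_const _) (hi i),
        integral_comp_eval (μ := fun _ : ι => ν) (hf x).aestronglyMeasurable]
      simp
    rw [heq]
    refine abs_integral_le_integral_abs.trans
      (integral_mono (integrable_finsetSum _ fun i _ => hd i).abs hsup fun u' => ?_)
    exact le_ciSup (f := fun x => |∑ i, (f x (u i) - f x (u' i))|)
      ⟨_, Set.forall_mem_range.2 (hpair u')⟩ x
  -- The supremum has been moved inside the integral over the second sample; Jensen's inequality now
  -- moves `exp` inside.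
  refine (Real.exp_le_exp.2 (mul_le_mul_of_nonneg_left hle hc)).trans ?_
  rw [← integral_const_mul]
  exact convexOn_exp.map_integral_le Real.continuous_exp.continuousOn isClosed_univ
    (Filter.Eventually.of_forall fun _ => Set.mem_univ _) (hsup.const_mul c)
    (integrable_exp_iSup_abs hmeas hn (fun x u' => hpair u' x) hc)

/-- Integrates the previous bound over the first sample and regroups a pair of samples as a sample
of pairs, the form in which coordinates can be swapped. -/
theorem integral_exp_iSup_le_integral_prod [MeasurableSpace E] [Countable C] (ν : Measure E)
    [IsProbabilityMeasure ν] (f : C → E → ℝ) (hf : ∀ x, Measurable (f x))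
    (h0 : ∀ x e, 0 ≤ f x e) (h1 : ∀ x e, f x e ≤ 1) {c : ℝ} (hc : 0 ≤ c) :
    ∫ u : ι → E, Real.exp (c * ⨆ x, |∑ i, (f x (u i) - ∫ e, f x e ∂ν)|)
      ∂(Measure.pi fun _ => ν) ≤
      ∫ w : ι → E × E, Real.exp (c * ⨆ x, |∑ i, (f x (w i).1 - f x (w i).2)|)
        ∂(Measure.pi fun _ => ν.prod ν) := by
  have hn : (0 : ℝ) ≤ Fintype.card ι := Nat.cast_nonneg _
  have hmp := measurePreserving_arrowProdEquivProdArrow E E ι (fun _ => ν) (fun _ => ν)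
  have hprod : Integrable (fun p : (ι → E) × (ι → E) =>
      Real.exp (c * ⨆ x, |∑ i, (f x (p.1 i) - f x (p.2 i))|))
      ((Measure.pi fun _ => ν).prod (Measure.pi fun _ => ν)) := by
    have hm : ∀ x, Measurable fun p : (ι → E) × (ι → E) => ∑ i, (f x (p.1 i) - f x (p.2 i)) :=
      fun x => by
        have := hf x
        fun_prop
    exact integrable_exp_iSup_abs hm hn (fun x p => by
      simpa using abs_sum_sign_mul_sub_le h0 h1 (fun _ => 1) (fun i => (p.1 i, p.2 i)) x) hc
  have hleft : Integrable (fun u : ι → E =>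
      Real.exp (c * ⨆ x, |∑ i, (f x (u i) - ∫ e, f x e ∂ν)|)) (Measure.pi fun _ => ν) := by
    have hm : ∀ x, Measurable fun u : ι → E => ∑ i, (f x (u i) - ∫ e, f x e ∂ν) :=
      fun x => by
        have := hf x
        fun_prop
    exact integrable_exp_iSup_abs hm hn (fun x u => abs_sum_sub_integral_le h0 h1 u x) hc
  refine (integral_mono hleft hprod.integral_prod_left fun u =>
    exp_iSup_abs_sum_sub_integral_le ν f hf h0 h1 hc u).trans ?_
  rw [← integral_prod _ hprod, ← hmp.map_eq, integral_map_equiv]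
  rfl

/-- **Symmetrization**: exponential moments of the deviation of an empirical process are bounded
by averages over random signs of the differences of two samples. -/
theorem integral_exp_iSup_le [DecidableEq ι] [MeasurableSpace E] [Countable C] (ν : Measure E)
    [IsProbabilityMeasure ν] (f : C → E → ℝ) (hf : ∀ x, Measurable (f x))
    (h0 : ∀ x e, 0 ≤ f x e) (h1 : ∀ x e, f x e ≤ 1) {c : ℝ} (hc : 0 ≤ c) {B : ℝ}
    (hB : ∀ w : ι → E × E, ∃ b : (ι → ℤˣ) → ℝ, (∀ ε, 0 ≤ b ε) ∧
      (∀ ε x, |∑ i, ((ε i : ℤ) : ℝ) * (f x (w i).1 - f x (w i).2)| ≤ b ε) ∧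
      ∑ ε, Real.exp (c * b ε) ≤ Fintype.card (ι → ℤˣ) * B) :
    ∫ u : ι → E, Real.exp (c * ⨆ x, |∑ i, (f x (u i) - ∫ e, f x e ∂ν)|)
      ∂(Measure.pi fun _ => ν) ≤ B := by
  refine (integral_exp_iSup_le_integral_prod ν f hf h0 h1 hc).trans ?_
  have hint : ∀ ε : ι → ℤˣ, Integrable (fun w : ι → E × E =>
      Real.exp (c * ⨆ x, |∑ i, ((ε i : ℤ) : ℝ) * (f x (w i).1 - f x (w i).2)|))
      (Measure.pi fun _ => ν.prod ν) := fun ε => by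
    have hm : ∀ x, Measurable fun w : ι → E × E =>
        ∑ i, ((ε i : ℤ) : ℝ) * (f x (w i).1 - f x (w i).2) := fun x => by
      have := hf x
      fun_prop
    exact integrable_exp_iSup_abs hm (Nat.cast_nonneg _)
      (fun x w => abs_sum_sign_mul_sub_le h0 h1 ε w x) hc
  have hcard : (0 : ℝ) < Fintype.card (ι → ℤˣ) := by exact_mod_cast Fintype.card_pos
  refine le_of_mul_le_mul_left ?_ hcard
  -- All sign patterns give the same integral, so one integral may be replaced by the average over
  -- signs; `hB` then applies pointwise in the samples.
  calc (Fintype.card (ι → ℤˣ) : ℝ) *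
        ∫ w : ι → E × E, Real.exp (c * ⨆ x, |∑ i, (f x (w i).1 - f x (w i).2)|)
          ∂(Measure.pi fun _ => ν.prod ν)
      = ∫ w : ι → E × E, ∑ ε : ι → ℤˣ,
          Real.exp (c * ⨆ x, |∑ i, ((ε i : ℤ) : ℝ) * (f x (w i).1 - f x (w i).2)|)
          ∂(Measure.pi fun _ => ν.prod ν) := by
        rw [integral_finsetSum _ fun ε _ => hint ε,
          Finset.sum_congr rfl fun ε _ => integral_signed_eq ν f hf c ε, Finset.sum_const,
          Finset.card_univ, nsmul_eq_mul]
    _ ≤ ∫ _w : ι → E × E, (Fintype.card (ι → ℤˣ) : ℝ) * B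
          ∂(Measure.pi fun _ => ν.prod ν) := by
        refine integral_mono (integrable_finsetSum _ fun ε _ => hint ε) (integrable_const _)
          fun w => ?_
        obtain ⟨b, hb0, hb, hsum⟩ := hB w
        refine le_trans (Finset.sum_le_sum fun ε _ => ?_) hsum
        exact Real.exp_le_exp.2 (mul_le_mul_of_nonneg_left (Real.iSup_le (hb ε) (hb0 ε)) hc)
    _ = _ := by simp

end Symmetrization

/-! ### Eigenvalue counting for Hermitian matrices -/

section Counting

variable {n m : Type*} [Fintype n] [DecidableEq n] [Fintype m] [DecidableEq m]

/-- The characteristic polynomial is insensitive to relabelling the basis, which is what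
translations require. -/
theorem card_eigenvalues_le_eq_countP {A : Matrix n n ℂ} (hA : A.IsHermitian) (x : ℝ) :
    Nat.card {i // hA.eigenvalues i ≤ x} = A.charpoly.roots.countP (fun t => t.re ≤ x) := by
  rw [hA.roots_charpoly_eq_eigenvalues, Multiset.countP_map, Nat.card_eq_fintype_card,
    Fintype.card_subtype]
  simp [Finset.card, Finset.filter]

/-- The eigenvalue counting function does not depend on the labelling of the basis. -/
theorem card_eigenvalues_le_reindex {A : Matrix n n ℂ} {B : Matrix m m ℂ} (hA : A.IsHermitian)
    (hB : B.IsHermitian) (e : n ≃ m) (h : ∀ i j, B (e i) (e j) = A i j) (x : ℝ) :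
    Nat.card {i // hB.eigenvalues i ≤ x} = Nat.card {i // hA.eigenvalues i ≤ x} := by
  have hBA : B = Matrix.reindex e e A := by
    ext i j
    rw [Matrix.reindex_apply, Matrix.submatrix_apply, ← h, e.apply_symm_apply, e.apply_symm_apply]
  rw [card_eigenvalues_le_eq_countP, card_eigenvalues_le_eq_countP, hBA, Matrix.charpoly_reindex]

theorem inner_toEuclideanLin_eigenvectorBasis {A : Matrix n n ℂ} (hA : A.IsHermitian) (i : n)
    (v : EuclideanSpace ℂ n) :
    inner ℂ (hA.eigenvectorBasis i) (Matrix.toEuclideanLin A v) =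
      hA.eigenvalues i * inner ℂ (hA.eigenvectorBasis i) v := by
  have hsymm := Matrix.isSymmetric_toEuclideanLin_iff.mpr hA
  rw [← hsymm (hA.eigenvectorBasis i) v]
  have : Matrix.toEuclideanLin A (hA.eigenvectorBasis i) =
      (hA.eigenvalues i : ℂ) • hA.eigenvectorBasis i := by
    ext j
    have := congrFun (hA.mulVec_eigenvectorBasis i) j
    simpa [Matrix.toLpLin_apply] using this
  rw [this, inner_smul_left, Complex.conj_ofReal]

/-- The quadratic form of a Hermitian matrix in an eigenbasis. -/
theorem re_inner_toEuclideanLin_eq {A : Matrix n n ℂ} (hA : A.IsHermitian)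
    (v : EuclideanSpace ℂ n) :
    (inner ℂ v (Matrix.toEuclideanLin A v)).re =
      ∑ i, hA.eigenvalues i * ‖inner ℂ (hA.eigenvectorBasis i) v‖ ^ 2 := by
  rw [← hA.eigenvectorBasis.sum_inner_mul_inner v, Complex.re_sum]
  refine Finset.sum_congr rfl fun i _ => ?_
  rw [inner_toEuclideanLin_eigenvectorBasis, mul_left_comm, ← inner_conj_symm v,
    Complex.conj_mul']
  norm_cast

theorem inner_eigenvectorBasis_eq_zero {A : Matrix n n ℂ} (hA : A.IsHermitian) {p : n → Prop}
    {v : EuclideanSpace ℂ n}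
    (hv : v ∈ Submodule.span ℂ (Set.range fun i : {i // p i} => hA.eigenvectorBasis i)) {i : n}
    (hi : ¬ p i) : inner ℂ (hA.eigenvectorBasis i) v = 0 := by
  induction hv using Submodule.span_induction with
  | mem v hv =>
    obtain ⟨j, rfl⟩ := hv
    exact hA.eigenvectorBasis.orthonormal.2 fun h => hi (h ▸ j.2)
  | zero => exact inner_zero_right _
  | add v w _ _ hv hw => rw [inner_add_right, hv, hw, add_zero]
  | smul c v _ hv => rw [inner_smul_right, hv, mul_zero]

theorem finrank_span_eigenvectorBasis {A : Matrix n n ℂ} (hA : A.IsHermitian) (p : n → Prop) :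
    Module.finrank ℂ (Submodule.span ℂ (Set.range fun i : {i // p i} => hA.eigenvectorBasis i)) =
      Nat.card {i // p i} := by
  classical
  rw [finrank_span_eq_card, Nat.card_eq_fintype_card]
  exact hA.eigenvectorBasis.orthonormal.linearIndependent.comp _ Subtype.val_injective

/-- If the quadratic form exceeds `x` on a subspace, then the number of eigenvalues that are at
most `x` is bounded by the codimension of the subspace. -/
theorem finrank_add_card_eigenvalues_le {A : Matrix n n ℂ} (hA : A.IsHermitian) (x : ℝ)
    (V : Submodule ℂ (EuclideanSpace ℂ n))
    (hV : ∀ v ∈ V, v ≠ 0 → x * ‖v‖ ^ 2 < (inner ℂ v (Matrix.toEuclideanLin A v)).re) :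
    Module.finrank ℂ V + Nat.card {i // hA.eigenvalues i ≤ x} ≤ Fintype.card n := by
  rw [← finrank_span_eigenvectorBasis hA (fun i => hA.eigenvalues i ≤ x),
    ← finrank_euclideanSpace (𝕜 := ℂ) (ι := n)]
  -- On the span of the eigenvectors with eigenvalue at most `x` the form is at most `x * ‖v‖ ^ 2`,
  -- so this span meets `V` only in zero.
  refine Submodule.finrank_add_finrank_le_of_disjoint (Submodule.disjoint_def.2 fun v hvV hv => ?_)
  by_contra hne
  refine (hV v hvV hne).not_ge ?_
  rw [re_inner_toEuclideanLin_eq hA, ← hA.eigenvectorBasis.sum_sq_norm_inner_right v,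
    Finset.mul_sum]
  refine Finset.sum_le_sum fun i _ => ?_
  by_cases hi : hA.eigenvalues i ≤ x
  · exact mul_le_mul_of_nonneg_right hi (sq_nonneg _)
  · simp [inner_eigenvectorBasis_eq_zero hA hv hi]

/-- Finitely many eigenvalues leave a gap to the right of `x`; its width is the admissible size of a
perturbation. -/
theorem exists_forall_lt_add_le {α : Type*} [Fintype α] (g : α → ℝ) (x : ℝ) :
    ∃ δ > 0, ∀ i, x < g i → x + δ ≤ g i := by
  by_cases h : ∃ i, x < g i
  · obtain ⟨i, hi, hmin⟩ := Finset.exists_min_image (Finset.univ.filter fun i => x < g i) g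
      (by simpa [Finset.Nonempty] using h)
    refine ⟨g i - x, by simpa using hi, fun j hj => ?_⟩
    linarith [hmin j (by simpa using hj)]
  · exact ⟨1, one_pos, fun i hi => (h ⟨i, hi⟩).elim⟩

/-- A small diagonal perturbation does not increase the number of eigenvalues that are at most
`x`. -/
theorem exists_card_eigenvalues_le {A : Matrix n n ℂ} (hA : A.IsHermitian) (x : ℝ) :
    ∃ δ > 0, ∀ (w : n → ℝ) (B : Matrix n n ℂ) (hB : B.IsHermitian), (∀ i, |w i| < δ) →
      B = A + Matrix.diagonal (fun i => (w i : ℂ)) →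
      Nat.card {i // hB.eigenvalues i ≤ x} ≤ Nat.card {i // hA.eigenvalues i ≤ x} := by
  obtain ⟨δ, hδ, hgap⟩ := exists_forall_lt_add_le hA.eigenvalues x
  refine ⟨δ, hδ, fun w B hB hw hBA => ?_⟩
  -- On the spectral subspace above `x` the form of `A` is at least `x + δ`, and the perturbation
  -- lowers it by strictly less than `δ`.
  set V := Submodule.span ℂ
    (Set.range fun i : {i // x < hA.eigenvalues i} => hA.eigenvectorBasis i) with hVdef
  have hA_V : ∀ v ∈ V, (x + δ) * ‖v‖ ^ 2 ≤ (inner ℂ v (Matrix.toEuclideanLin A v)).re := by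
    intro v hv
    rw [re_inner_toEuclideanLin_eq hA, ← hA.eigenvectorBasis.sum_sq_norm_inner_right v,
      Finset.mul_sum]
    refine Finset.sum_le_sum fun i _ => ?_
    by_cases hi : x < hA.eigenvalues i
    · exact mul_le_mul_of_nonneg_right (hgap i hi) (sq_nonneg _)
    · simp [inner_eigenvectorBasis_eq_zero hA hv hi]
  have hdiag : ∀ v : EuclideanSpace ℂ n, v ≠ 0 → -(δ * ‖v‖ ^ 2) <
      (inner ℂ v (Matrix.toEuclideanLin (Matrix.diagonal fun i => (w i : ℂ)) v)).re := by
    intro v hv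
    have heq : (inner ℂ v (Matrix.toEuclideanLin (Matrix.diagonal fun i => (w i : ℂ)) v)).re =
        ∑ i, w i * ‖v i‖ ^ 2 := by
      rw [PiLp.inner_apply, Complex.re_sum]
      refine Finset.sum_congr rfl fun i _ => ?_
      have : (Matrix.toEuclideanLin (Matrix.diagonal fun i => (w i : ℂ)) v) i = w i * v i := by
        simp [Matrix.toLpLin_apply, Matrix.mulVec_diagonal]
      rw [this, RCLike.inner_apply, mul_assoc, Complex.mul_conj']
      norm_cast
    obtain ⟨j, hj⟩ : ∃ j, v j ≠ 0 := by
      by_contra! h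
      exact hv (by ext j; exact h j)
    rw [heq, EuclideanSpace.norm_sq_eq, Finset.mul_sum, ← Finset.sum_neg_distrib]
    refine Finset.sum_lt_sum (fun i _ => ?_) ⟨j, Finset.mem_univ j, ?_⟩
    · nlinarith [(abs_lt.1 (hw i)).1, sq_nonneg ‖v i‖]
    · have : 0 < ‖v j‖ ^ 2 := by positivity
      nlinarith [(abs_lt.1 (hw j)).1]
  have hV : ∀ v ∈ V, v ≠ 0 → x * ‖v‖ ^ 2 < (inner ℂ v (Matrix.toEuclideanLin B v)).re := by
    intro v hv hne
    rw [hBA, map_add, LinearMap.add_apply, inner_add_right, Complex.add_re]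
    linarith [hA_V v hv, hdiag v hne]
  have hdim := finrank_add_card_eigenvalues_le hB x V hV
  rw [hVdef, finrank_span_eigenvectorBasis] at hdim
  have hcompl : Nat.card {i // x < hA.eigenvalues i} + Nat.card {i // hA.eigenvalues i ≤ x} =
      Fintype.card n := by
    have := Fintype.card_subtype_compl (fun i => hA.eigenvalues i ≤ x)
    have hle := Fintype.card_subtype_le (fun i => hA.eigenvalues i ≤ x)
    simp only [not_le] at this
    rw [Nat.card_eq_fintype_card, Nat.card_eq_fintype_card, this]
    omega
  omega

end Counting

/-! ### Locality, covariance and measurability of the counting function -/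

section Anderson

variable {d : ℕ}

/-- The configuration that agrees with `u` on `Λ` and vanishes elsewhere. -/
noncomputable def zeroExtend (Λ : Finset (Site d)) (u : Λ → ℝ) : Config d :=
  Function.extend Subtype.val u 0

theorem zeroExtend_coe (Λ : Finset (Site d)) (u : Λ → ℝ) (a : Λ) : zeroExtend Λ u a = u a :=
  Subtype.val_injective.extend_apply u 0 a

theorem card_neighbors_add (x z : Site d) : (neighbors (x + z)).card = (neighbors x).card := by
  have : neighbors (x + z) = (neighbors x).map (addRightEmbedding z) := by
    ext y
    simp only [Finset.mem_map, mem_neighbors, addRightEmbedding_apply]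
    constructor
    · exact fun h => ⟨y - z, by rw [← h]; simp [l1Dist, sub_sub, add_comm], by simp⟩
    · rintro ⟨a, ha, rfl⟩
      rw [← ha]
      simp [l1Dist]
  rw [this, Finset.card_map]

/-- The labelling of a translated set by the original one. -/
noncomputable def translateEquiv (z : Site d) (Λ : Finset (Site d)) : Λ ≃ translateBy z Λ :=
  Equiv.ofBijective
    (fun a => ⟨a + z, Finset.mem_map_of_mem (addRightEmbedding z) a.2⟩)
    ⟨fun a b h => Subtype.ext (add_right_cancel (Subtype.ext_iff.1 h)), fun y => by
      obtain ⟨a, ha, hay⟩ := Finset.mem_map.1 y.2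
      exact ⟨⟨a, ha⟩, Subtype.ext hay⟩⟩

/-- Counting eigenvalues on a translated set amounts to translating the potential. -/
theorem evcf_translateBy (z : Site d) (Λ : Finset (Site d)) (ω ω' : Config d)
    (h : ∀ a ∈ Λ, ω' a = ω (a + z)) (x : ℝ) :
    evcf (translateBy z Λ) ω x = evcf Λ ω' x := by
  refine card_eigenvalues_le_reindex _ _ (translateEquiv z Λ) (fun a b => ?_) x
  have hval : ∀ a : Λ, ((translateEquiv z Λ a : translateBy z Λ) : Site d) = a + z := fun a => rfl
  have hdist : l1Dist ((b : Site d) + z) (a + z) = l1Dist (b : Site d) a := by simp [l1Dist]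
  rw [restricted_apply, restricted_apply, hval, hval, card_neighbors_add, hdist, h a a.2]
  simp only [EmbeddingLike.apply_eq_iff_eq]

/-- The potential enters the matrix only through its diagonal on `Λ`, so the count is a function of
finitely many coordinates. -/
theorem evcf_congr (Λ : Finset (Site d)) (ω ω' : Config d) (h : ∀ a ∈ Λ, ω' a = ω a) (x : ℝ) :
    evcf Λ ω x = evcf Λ ω' x := by
  refine card_eigenvalues_le_reindex _ _ (Equiv.refl Λ) (fun a b => ?_) x
  rw [restricted_apply, restricted_apply, Equiv.refl_apply, Equiv.refl_apply, h a a.2]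

theorem evcf_le_card (Λ : Finset (Site d)) (ω : Config d) (x : ℝ) : evcf Λ ω x ≤ Λ.card := by
  rw [evcf, Nat.card_eq_fintype_card, ← Fintype.card_coe]
  exact Fintype.card_subtype_le _

theorem evcf_eq_sum (Λ : Finset (Site d)) (ω : Config d) (x : ℝ) :
    (evcf Λ ω x : ℝ) =
      ∑ k, if (restricted_isHermitian Λ ω).eigenvalues k ≤ x then (1 : ℝ) else 0 := by
  rw [evcf, Nat.card_eq_fintype_card, Fintype.card_subtype, Finset.sum_boole]

/-- The eigenvalue counting function is upper semicontinuous in the potential. -/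
theorem measurable_evcf_zeroExtend (Λ : Finset (Site d)) (x : ℝ) :
    Measurable fun u : Λ → ℝ => (evcf Λ (zeroExtend Λ u) x : ℝ) := by
  refine UpperSemicontinuous.measurable fun u y hy => ?_
  obtain ⟨δ, hδ, h⟩ := exists_card_eigenvalues_le (restricted_isHermitian Λ (zeroExtend Λ u)) x
  filter_upwards [Metric.ball_mem_nhds u hδ] with u' hu'
  refine lt_of_le_of_lt ?_ hy
  refine Nat.cast_le.2 (h (fun a => u' a - u a) _ _ (fun a => ?_) ?_)
  · rw [← Real.dist_eq]
    exact (dist_le_pi_dist u' u a).trans_lt hu'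
  · ext a b
    rw [Matrix.add_apply, restricted_apply, restricted_apply, zeroExtend_coe, zeroExtend_coe,
      Matrix.diagonal_apply]
    split_ifs <;> push_cast <;> ring

end Anderson

/-! ### Numerical constants and countability of the quantile set -/

section Constants

theorem summable_entropyTerm : Summable entropyTerm := by
  have hgeom : Summable fun q : ℕ => ((1 : ℝ) / 2) ^ q :=
    summable_geometric_of_lt_one (by norm_num) (by norm_num)
  have hhalf : ‖(1 / 2 : ℝ)‖ < 1 := by norm_num
  have hpow : Summable fun q : ℕ => (q : ℝ) ^ 1 * (1 / 2 : ℝ) ^ q :=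
    summable_pow_mul_geometric_of_norm_lt_one 1 hhalf
  refine Summable.of_nonneg_of_le (fun q => by unfold entropyTerm; positivity) (fun q => ?_)
    ((hgeom.mul_left 2).add (hpow.mul_left 2))
  have hlog : Real.log 2 ≤ 1 := by linarith [Real.log_two_lt_d9]
  have hlog0 : 0 ≤ Real.log 2 := Real.log_nonneg one_le_two
  have hq : (0 : ℝ) ≤ q := Nat.cast_nonneg q
  have hsqrt : √(2 + 2 * (q : ℝ) * Real.log 2) ≤ 2 + 2 * q := by
    refine Real.sqrt_le_iff.2 ⟨by positivity, ?_⟩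
    have := mul_le_mul_of_nonneg_left hlog hq
    nlinarith
  calc entropyTerm q ≤ ((2 : ℝ) ^ q)⁻¹ * (2 + 2 * q) :=
        mul_le_mul_of_nonneg_left hsqrt (by positivity)
    _ = _ := by rw [one_div, inv_pow]; ring

/-- Since `log (3/2) ≤ 1` and `M - 1 ≤ M + 1`, the fraction multiplied by `10` is at least `4`; the
series is at least its zeroth term `√2`. -/
theorem forty_le_concConst {M : ℝ} (hM : 2 ≤ M) : 40 ≤ concConst M := by
  have hS : 1 ≤ ∑' q : ℕ, entropyTerm q := by
    refine le_trans ?_ (summable_entropyTerm.le_tsum 0 fun q _ => by unfold entropyTerm; positivity)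
    simp only [entropyTerm, pow_zero, inv_one, Nat.cast_zero, mul_zero, zero_mul, add_zero, one_mul]
    exact Real.one_le_sqrt.2 one_le_two
  have hL : 0 < Real.log (3 / 2) := Real.log_pos (by norm_num)
  have hL1 : Real.log (3 / 2) ≤ 1 := by
    linarith [Real.log_le_sub_one_of_pos (show (0 : ℝ) < 3 / 2 by norm_num)]
  have hlogM : 0 ≤ 4 / Real.log M := div_nonneg (by norm_num) (Real.log_nonneg (by linarith))
  have hfrac : 4 ≤ 4 * (M + 1) / (Real.log (3 / 2) * (M - 1)) := by
    rw [le_div_iff₀ (mul_pos hL (by linarith))]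
    nlinarith
  have h40 : 40 ≤ 10 * (4 * (M + 1) / (Real.log (3 / 2) * (M - 1))) + 4 / Real.log M := by linarith
  exact h40.trans (le_mul_of_one_le_right (by linarith) hS)

/-- In the nontrivial case `exp (-τ) < 1 / M ≤ 1/2`. Two of the three factors `exp (-τ)` then
contribute at most `1/4`, which reduces the prefactor, at most `8`, to `2 ≤ M`. -/
theorem le_mul_exp_of_le_exp_three {p τ K M : ℝ} (hK : 40 ≤ K) (hM : 2 ≤ M) (hp1 : p ≤ 1)
    (hp : p ≤ Real.exp (-(3 * τ)) * (4 * Real.exp (18 / K ^ 2))) : p ≤ M * Real.exp (-τ) := by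
  by_cases hcase : 1 ≤ M * Real.exp (-τ)
  · exact hp1.trans hcase
  have hpos := Real.exp_pos (-τ)
  have hhalf : Real.exp (-τ) ≤ 1 / 2 := by nlinarith
  have hthree : Real.exp (-(3 * τ)) = Real.exp (-τ) ^ 2 * Real.exp (-τ) := by
    rw [← pow_succ, ← Real.exp_nat_mul]
    norm_num
  have htwo : Real.exp (18 / K ^ 2) ≤ 2 := by
    rw [← Real.le_log_iff_exp_le two_pos]
    have : 18 / K ^ 2 ≤ 1 / 2 := by
      rw [div_le_iff₀ (by positivity)]
      nlinarith
    linarith [Real.log_two_gt_d9]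
  have hsq : Real.exp (-τ) ^ 2 ≤ 1 / 4 := by nlinarith
  have hpos' := Real.exp_pos (18 / K ^ 2)
  calc p ≤ Real.exp (-τ) ^ 2 * Real.exp (-τ) * (4 * Real.exp (18 / K ^ 2)) := hthree ▸ hp
    _ ≤ 1 / 4 * Real.exp (-τ) * (4 * 2) := by gcongr
    _ = 2 * Real.exp (-τ) := by ring
    _ ≤ M * Real.exp (-τ) := mul_le_mul_of_nonneg_right hM hpos.le

theorem countable_rationalQuantiles (F : ℝ → ℝ) : (rationalQuantiles F).Countable := by
  refine (Set.countable_range fun q : ℚ => (quantile F (q : ℝ)).toReal).mono ?_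
  rintro x ⟨q, hq⟩
  exact ⟨q, by simp [hq]⟩

end Constants

/-! ### Independent copies and the exponential moment bound -/

section Probability

variable {d : ℕ}

/-- The potentials on separated translates of `Λ` are independent copies of the potential
on `Λ`. -/
theorem map_translates_eq_pi {P : Measure (Config d)} [IsProbabilityMeasure P] {r : ℝ≥0}
    (hinv : TranslationInvariant P) (hind : IndependentAtDistance P r) {Λ : Finset (Site d)}
    (hne : Λ.Nonempty) {s : ℕ} (z : Fin s → Site d)
    (hsep : ∀ i j, i ≠ j → (r : ℝ≥0∞) <
      setDist (translateBy (z i) Λ : Set (Site d)) (translateBy (z j) Λ : Set (Site d))) :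
    P.map (fun ω (i : Fin s) (a : Λ) => ω (a + z i)) =
      Measure.pi fun _ => P.map fun ω (a : Λ) => ω a := by
  have hmem : ∀ i, ∀ a : Λ, (a : Site d) + z i ∈ translateBy (z i) Λ := fun i a =>
    Finset.mem_map_of_mem (addRightEmbedding (z i)) a.2
  have hindep : iIndepFun (fun (i : Fin s) (ω : Config d) (a : Λ) => ω (a + z i)) P :=
    (hind s (fun i => translateBy (z i) Λ) (fun i => hne.map) hsep).comp
      (fun i ξ (a : Λ) => ξ ⟨a + z i, hmem i a⟩)
      (fun i => measurable_pi_lambda _ fun a => measurable_pi_apply _)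
  have hmeas : ∀ i, Measurable fun (ω : Config d) (a : Λ) => ω (a + z i) := fun i =>
    measurable_pi_lambda _ fun a => measurable_pi_apply _
  have hmeas0 : Measurable fun (ω : Config d) (a : Λ) => ω a :=
    measurable_pi_lambda _ fun a => measurable_pi_apply _
  rw [(iIndepFun_iff_map_fun_eq_pi_map fun i => (hmeas i).aemeasurable).1 hindep]
  congr 1
  funext i
  -- Independence has given a product of marginals; invariance under `shift (z i)` identifies each
  -- marginal with the law on `Λ`.
  conv_rhs => rw [← (hinv (z i)).map_eq]
  rw [Measure.map_map hmeas0 (hinv (z i)).measurable]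
  rfl

/-- Exponential moments of the deviation of averaged normalized eigenvalue counting functions of
independent samples of the potential. -/
theorem integral_exp_iSup_evcf_le {Λ : Finset (Site d)} (hne : Λ.Nonempty) (ν : Measure (Λ → ℝ))
    [IsProbabilityMeasure ν] {N : ℝ} (hN : Λ.card ≤ N) {C : Set ℝ} (hC : C.Countable) (s : ℕ)
    {c : ℝ} (hc : 0 ≤ c) :
    ∫ u : Fin s → Λ → ℝ, Real.exp (c * ⨆ x : C, |∑ i, ((evcf Λ (zeroExtend Λ (u i)) x : ℝ) / N -
        ∫ e, (evcf Λ (zeroExtend Λ e) x : ℝ) / N ∂ν)|) ∂(Measure.pi fun _ => ν) ≤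
      4 * Real.exp (2 * s * c ^ 2) := by
  have : Countable C := hC.to_subtype
  have : Nonempty Λ := hne.to_subtype
  have hN0 : 0 < N := lt_of_lt_of_le (by exact_mod_cast hne.card_pos) hN
  refine integral_exp_iSup_le ν
    (fun (x : C) (u : Λ → ℝ) => (evcf Λ (zeroExtend Λ u) x : ℝ) / N)
    (fun x => (measurable_evcf_zeroExtend Λ x).div_const N) (fun x u => by positivity)
    (fun x u => (div_le_one hN0).2 ((Nat.cast_le.2 (evcf_le_card Λ _ _)).trans hN)) hc fun w => ?_
  -- For fixed samples the count is a sum over labels `k` of half-line indicators at the `k`-th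
  -- eigenvalue.
  obtain ⟨b, hb0, hb, hsum⟩ := exists_exp_bound_sub
    (fun k i => (restricted_isHermitian Λ (zeroExtend Λ (w i).1)).eigenvalues k)
    (fun k i => (restricted_isHermitian Λ (zeroExtend Λ (w i).2)).eigenvalues k)
    (N := N) (by rwa [Fintype.card_coe]) c
  refine ⟨b, hb0, fun ε x => ?_, by simpa using hsum⟩
  simp only [evcf_eq_sum]
  exact hb ε x

end Probability

end AndersonIDS

/-! ### The concentration inequality -/

theorem mainTheorem6 (d : ℕ) (hd : 1 ≤ d)
    (P : Measure (Config d)) [IsProbabilityMeasure P]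
    (r : ℝ≥0)
    (hinv : TranslationInvariant P) (hind : IndependentAtDistance P r)
    (m : ℕ) (hne : (core r (cube d m)).Nonempty)
    (s : ℕ) (hs : 1 ≤ s) (z : Fin s → Site d)
    (hsep : ∀ i j, i ≠ j →
      (r : ℝ≥0∞) < setDist (translateBy (z i) (core r (cube d m)) : Set (Site d))
        (translateBy (z j) (core r (cube d m)) : Set (Site d)))
    (M : ℝ) (hM : 2 ≤ M) (κ : ℝ) (hκ : 0 < κ) :
    Summable entropyTerm ∧
    P.real {ω : Config d |
        κ ≤ ⨆ x : rationalQuantiles (meanEvcf P r m),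
          |(1 / (s : ℝ)) * ∑ i : Fin s,
              (evcf (translateBy (z i) (core r (cube d m))) ω (x : ℝ) : ℝ)
                / ((cube d m).card : ℝ)
            - ∫ ω', (evcf (core r (cube d m)) ω' (x : ℝ) : ℝ)
                / ((cube d m).card : ℝ) ∂P|}
      ≤ M * Real.exp (-(√(s : ℝ) * κ / concConst M)) := by
  refine ⟨summable_entropyTerm, ?_⟩
  have hcard : ((core r (cube d m)).card : ℝ) ≤ (cube d m).card :=
    Nat.cast_le.2 (Finset.card_le_card (Finset.filter_subset _ _))
  have hC := countable_rationalQuantiles (meanEvcf P r m)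
  -- From here on `C` is any countable set and `Λ` any nonempty finite set with at most `N` points.
  generalize rationalQuantiles (meanEvcf P r m) = C at hC ⊢
  generalize core r (cube d m) = Λ at *
  generalize ((cube d m).card : ℝ) = N at *
  have : Countable C := hC.to_subtype
  have hs0 : (0 : ℝ) < s := by exact_mod_cast hs
  have hK := forty_le_concConst hM
  have hK0 : 0 < concConst M := by linarith
  have hres : Measurable fun (ω : Config d) (a : Λ) => ω a :=
    measurable_pi_lambda _ fun a => measurable_pi_apply _
  set ν := P.map fun (ω : Config d) (a : Λ) => ω a with hν
  have : IsProbabilityMeasure ν := Measure.isProbabilityMeasure_map hres.aemeasurable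
  set X : Config d → Fin s → Λ → ℝ := fun ω i a => ω (a + z i) with hX
  have hXmeas : Measurable X := measurable_pi_lambda _ fun i => measurable_pi_lambda _ fun a =>
    measurable_pi_apply _
  have hlaw : P.map X = Measure.pi fun _ => ν := map_translates_eq_pi hinv hind hne z hsep
  set Z : (Fin s → Λ → ℝ) → ℝ := fun u => ⨆ x : C,
    |∑ i, ((evcf Λ (zeroExtend Λ (u i)) x : ℝ) / N -
        ∫ e, (evcf Λ (zeroExtend Λ e) x : ℝ) / N ∂ν)| with hZ
  have hfm : ∀ x : ℝ, Measurable fun u : Λ → ℝ => (evcf Λ (zeroExtend Λ u) x : ℝ) / N :=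
    fun x => (measurable_evcf_zeroExtend Λ x).div_const N
  have hZm : ∀ x : C, Measurable fun u : Fin s → Λ → ℝ =>
      ∑ i, ((evcf Λ (zeroExtend Λ (u i)) x : ℝ) / N -
        ∫ e, (evcf Λ (zeroExtend Λ e) x : ℝ) / N ∂ν) := fun x =>
    Finset.measurable_sum _ fun i _ => ((hfm x).comp (measurable_pi_apply i)).sub_const _
  have hset : {ω : Config d | κ ≤ ⨆ x : C, |(1 / (s : ℝ)) * ∑ i : Fin s,
      (evcf (translateBy (z i) Λ) ω (x : ℝ) : ℝ) / N - ∫ ω', (evcf Λ ω' (x : ℝ) : ℝ) / N ∂P|} =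
      X ⁻¹' {u | s * κ ≤ Z u} := by
    ext ω
    have hpt : ∀ x : C, |(1 / (s : ℝ)) * ∑ i : Fin s,
        (evcf (translateBy (z i) Λ) ω (x : ℝ) : ℝ) / N - ∫ ω', (evcf Λ ω' (x : ℝ) : ℝ) / N ∂P| =
        (s : ℝ)⁻¹ * |∑ i, ((evcf Λ (zeroExtend Λ (X ω i)) x : ℝ) / N -
        ∫ e, (evcf Λ (zeroExtend Λ e) x : ℝ) / N ∂ν)| := by
      intro x
      have hint : ∫ e, (evcf Λ (zeroExtend Λ e) x : ℝ) / N ∂ν =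
          ∫ ω', (evcf Λ ω' (x : ℝ) : ℝ) / N ∂P := by
        rw [hν, integral_map hres.aemeasurable (hfm x).aestronglyMeasurable]
        refine integral_congr_ae (Filter.Eventually.of_forall fun ω' => ?_)
        simp only
        rw [evcf_congr Λ ω' (zeroExtend Λ fun a => ω' a)
          fun a ha => zeroExtend_coe Λ _ ⟨a, ha⟩]
      have htr : ∀ i, evcf (translateBy (z i) Λ) ω x = evcf Λ (zeroExtend Λ (X ω i)) x := fun i =>
        evcf_translateBy (z i) Λ ω _ (fun a ha => zeroExtend_coe Λ _ ⟨a, ha⟩) x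
      rw [hint, Finset.sum_sub_distrib, Finset.sum_const, Finset.card_univ, Fintype.card_fin,
        nsmul_eq_mul]
      conv_rhs => rw [← abs_of_pos (inv_pos.2 hs0), ← abs_mul, mul_sub,
        inv_mul_cancel_left₀ hs0.ne']
      simp only [htr, one_div]
    simp only [Set.mem_ofPred_eq, Set.mem_preimage, hpt]
    rw [← Real.mul_iSup_of_nonneg (inv_nonneg.2 hs0.le), inv_mul_eq_div, le_div_iff₀ hs0, mul_comm]
  -- With `τ = √s κ / K_M`, this parameter makes the Chernoff exponent `c * (s κ)` equal to `3τ`,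
  -- and `2 s c²` equal to `18 / K_M²`, free of `s`.
  have hc : 0 ≤ 3 / (concConst M * √s) := by positivity
  have hchernoff := measure_ge_le_exp_mul_mgf (μ := Measure.pi fun _ : Fin s => ν) (X := Z) (s * κ)
    hc (integrable_exp_iSup_abs hZm hs0.le (fun x u => ?_) hc)
  · rw [hset, ← map_measureReal_apply hXmeas
      (measurableSet_le measurable_const (Measurable.iSup fun x => (hZm x).abs)), hlaw]
    refine le_mul_exp_of_le_exp_three hK hM measureReal_le_one (hchernoff.trans ?_)
    have hsq : √(s : ℝ) ^ 2 = s := Real.sq_sqrt hs0.le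
    have hsqrt : 0 < √(s : ℝ) := Real.sqrt_pos.2 hs0
    have hexp : -(3 / (concConst M * √s)) * (s * κ) = -(3 * (√s * κ / concConst M)) := by
      field_simp
      rw [hsq]
    have hvar : 2 * s * (3 / (concConst M * √s)) ^ 2 = 18 / concConst M ^ 2 := by
      rw [div_pow, mul_pow, hsq]
      field_simp
      norm_num
    rw [hexp, ← hvar]
    exact mul_le_mul_of_nonneg_left (integral_exp_iSup_evcf_le hne ν hcard hC s hc)
      (Real.exp_pos _).le
  · have hN0 : 0 < N := lt_of_lt_of_le (by exact_mod_cast hne.card_pos) hcard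
    have := abs_sum_sub_integral_le (ν := ν)
      (f := fun (x : C) (u : Λ → ℝ) => (evcf Λ (zeroExtend Λ u) x : ℝ) / N)
      (fun x u => by positivity)
      (fun x u => (div_le_one hN0).2 ((Nat.cast_le.2 (evcf_le_card Λ _ _)).trans hcard)) u x
    rwa [Fintype.card_fin] at this
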